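/- Let $d,N\ge 1$, let $\mathbb{T}^d=\mathbb{R}^d/\mathbb{Z}^d$ be the flat torus with Lebesgue measure $d\xi$, and let $a=(a_{ij})\in C^2(\mathbb{T}^d;\mathbb{R}^{d\times d})$ and $b=(b_{ij})\in C^2(\mathbb{T}^d;\mathbb{R}^{N\times d})$ satisfy (E) there is a constant $\kappa>0$ with $|a(\xi)\zeta|^2\ge\kappa|\zeta|^2$ for all $\zeta\in\mathbb{R}^d$ and $\xi\in\mathbb{T}^d$; (D) $\sum_{j=1}^d\partial_j b_{ij}=0$ on $\mathbb{T}^d$ for every $1\le i\le N$; (R) for all $1\le l,j\le d$ and $1\le i\le N$, $$\sum_{k=1}^{d}\sum_{p=1}^{d}\left[b_{ik}(a_{pl}\partial_{k}a_{pj}+a_{pj}\partial_{k}a_{pl})-a_{pk}(a_{pj}\partial_{k}b_{il}+a_{pl}\partial_{k}b_{ij})\right]=0\quad\text{on }\mathbb{T}^{d}.$$ For $u,v\in H^1(\mathbb{T}^d)$ put $\mathcal{A}(u,v):=\int_{\mathbb{T}^d}\langle a\nabla u,a\nabla v\rangle\,d\xi$. Let $L^a$ be the operator on $L^2(\mathbb{T}^d)$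 associated with this form: $u\in D(L^a)$ and $L^au=w$ if and only if $u\in H^1(\mathbb{T}^d)$, $w\in L^2(\mathbb{T}^d)$ and $\mathcal{A}(u,v)=-(w,v)_{L^2(\mathbb{T}^d)}$ for all $v\in H^1(\mathbb{T}^d)$. For $\beta>0$ let $G^a_\beta:=(\beta-L^a)^{-1}$ be its resolvent on $L^2(\mathbb{T}^d)$, acting componentwise on $L^2(\mathbb{T}^d;\mathbb{R}^N)$. Then the following weak defective commutation condition holds: there is a constant $c\in\mathbb{R}$, and in fact a constant $c\le 0$, such that for every $\beta>0$ and every $f\in H^1(\mathbb{T}^d)$, $$\beta\int_{\mathbb{T}^{d}}\left\langle \beta\, G_{\beta}^{a}\,b\nabla f-\beta\, b\nabla G_{\beta}^{a}f,\;b\nabla f\right\rangle \,d\xi\;\ge\; c\,\mathcal{A}(f,f).$$ -/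

import Mathlib

open MeasureTheory
open scoped ContDiff RealInnerProductSpace ENNReal

namespace TorusForms

noncomputable section

/-- The flat torus `ℝ^d / ℤ^d`; its `volume` is the `d`-dimensional Lebesgue measure. -/
abbrev Torus (d : ℕ) : Type := UnitAddTorus (Fin d)

/-- The canonical projection `ℝ^d → ℝ^d / ℤ^d`. -/
def proj {d : ℕ} (x : Fin d → ℝ) : Torus d := fun i => (x i : UnitAddCircle)

/-- A real function on the torus is of class `C^n` if its periodic lift to `ℝ^d` is. -/
def IsCk {d : ℕ} (n : WithTop ℕ∞) (φ : Torus d → ℝ) : Prop :=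
  ContDiff ℝ n (fun x : Fin d → ℝ => φ (proj x))

/-- The classical partial derivative `∂_k φ` of a function on the torus. -/
def partialD {d : ℕ} (k : Fin d) (φ : Torus d → ℝ) (ξ : Torus d) : ℝ :=
  deriv (fun t : ℝ => φ (ξ + Pi.single k (t : UnitAddCircle))) 0

theorem isOpenQuotientMap_proj {d : ℕ} : IsOpenQuotientMap (proj (d := d)) :=
  IsOpenQuotientMap.piMap (f := fun (_ : Fin d) (t : ℝ) => (t : UnitAddCircle))
    fun _ => QuotientAddGroup.isOpenQuotientMap_mk

theorem IsCk.continuous {d : ℕ} {n : WithTop ℕ∞} {φ : Torus d → ℝ} (h : IsCk n φ) :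
    Continuous φ :=
  isOpenQuotientMap_proj.isQuotientMap.continuous_iff.2 (ContDiff.continuous h)

theorem partialD_proj {d : ℕ} {n : WithTop ℕ∞} {φ : Torus d → ℝ} (h : IsCk n φ) (hn : 1 ≤ n)
    (k : Fin d) (x : Fin d → ℝ) :
    partialD k φ (proj x) =
      fderiv ℝ (fun y : Fin d → ℝ => φ (proj y)) x (Pi.single k 1) := by
  have hd : DifferentiableAt ℝ (fun y : Fin d → ℝ => φ (proj y)) x :=
    (ContDiff.differentiable h (by intro h0; simp [h0] at hn)) x
  have hl : HasDerivAt (fun t : ℝ => x + t • (Pi.single k 1 : Fin d → ℝ)) (Pi.single k 1) 0 := by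
    simpa using ((hasDerivAt_id (0 : ℝ)).smul_const (Pi.single k 1 : Fin d → ℝ)).const_add x
  have hd' : HasFDerivAt (fun y : Fin d → ℝ => φ (proj y))
      (fderiv ℝ (fun y : Fin d → ℝ => φ (proj y)) x)
      (x + (0 : ℝ) • (Pi.single k 1 : Fin d → ℝ)) := by
    simpa using hd.hasFDerivAt
  have hc := hd'.comp_hasDerivAt (0 : ℝ) hl
  have he : (fun t : ℝ => φ (proj x + Pi.single k (t : UnitAddCircle))) =
      (fun y : Fin d → ℝ => φ (proj y)) ∘
        (fun t : ℝ => x + t • (Pi.single k 1 : Fin d → ℝ)) := by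
    funext t
    simp only [Function.comp]
    congr 1
    funext i
    by_cases hi : i = k
    · subst hi; simp [proj]
    · simp [proj, hi]
  unfold partialD
  rw [he]
  exact hc.deriv

theorem IsCk.continuous_partialD {d : ℕ} {n : WithTop ℕ∞} {φ : Torus d → ℝ} (h : IsCk n φ)
    (hn : 1 ≤ n) (k : Fin d) : Continuous (partialD k φ) := by
  refine isOpenQuotientMap_proj.isQuotientMap.continuous_iff.2 ?_
  have : partialD k φ ∘ proj =
      fun x => fderiv ℝ (fun y : Fin d → ℝ => φ (proj y)) x (Pi.single k 1) := by
    funext x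
    exact partialD_proj h hn k x
  rw [this]
  exact (ContDiff.continuous_fderiv h (by intro h0; simp [h0] at hn)).clm_apply continuous_const

/-- The real Hilbert space `H = L²(T^d)`. -/
abbrev L2 (d : ℕ) : Type := Lp ℝ 2 (volume : Measure (Torus d))

theorem integral_mul_eq_inner {d : ℕ} {ψ : Torus d → ℝ} (hψ : Continuous ψ) (u : L2 d) :
    ∫ ξ, u ξ * ψ ξ = ⟪ContinuousMap.toLp 2 volume ℝ (⟨ψ, hψ⟩ : C(Torus d, ℝ)), u⟫ := by
  rw [L2.inner_def]
  refine integral_congr_ae ?_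
  filter_upwards [ContinuousMap.coeFn_toLp (p := 2) (𝕜 := ℝ) (volume : Measure (Torus d))
    (⟨ψ, hψ⟩ : C(Torus d, ℝ))] with ξ hξ
  rw [hξ]
  simp

/-- `v` is the weak partial derivative `∂_k u` of `u ∈ L²(T^d)`. -/
def IsWeakPartial {d : ℕ} (k : Fin d) (u v : L2 d) : Prop :=
  ∀ φ : Torus d → ℝ, IsCk ∞ φ → ∫ ξ, u ξ * partialD k φ ξ = -∫ ξ, v ξ * φ ξ

theorem isWeakPartial_iff {d : ℕ} (k : Fin d) (u v : L2 d) : IsWeakPartial k u v ↔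
    ∀ (φ : Torus d → ℝ) (h : IsCk ∞ φ),
      ⟪ContinuousMap.toLp 2 volume ℝ
          (⟨partialD k φ, h.continuous_partialD (by simp) k⟩ : C(Torus d, ℝ)), u⟫ +
        ⟪ContinuousMap.toLp 2 volume ℝ (⟨φ, h.continuous⟩ : C(Torus d, ℝ)), v⟫ = 0 := by
  refine forall₂_congr fun φ h => ?_
  rw [integral_mul_eq_inner (h.continuous_partialD (by simp) k), integral_mul_eq_inner h.continuous,
    eq_neg_iff_add_eq_zero]

/-- The Sobolev space `S = H¹(T^d)`, as the Hilbert space of all pairs `(u, g)` of a function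
`u ∈ L²(T^d)` and its weak gradient `g ∈ L²(T^d; ℝ^d)`. -/
def sobolevH1 (d : ℕ) : Submodule ℝ (WithLp 2 (L2 d × PiLp 2 (fun _ : Fin d => L2 d))) where
  carrier := {p | ∀ k, IsWeakPartial k p.fst (p.snd k)}
  zero_mem' := by
    intro k
    rw [isWeakPartial_iff]
    intro φ h
    simp
  add_mem' := by
    intro p q hp hq k
    rw [isWeakPartial_iff]
    intro φ h
    have h1 := (isWeakPartial_iff k _ _).1 (hp k) φ h
    have h2 := (isWeakPartial_iff k _ _).1 (hq k) φ h
    simp only [WithLp.add_fst, WithLp.add_snd, PiLp.add_apply, inner_add_right]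
    linarith
  smul_mem' := by
    intro c p hp k
    rw [isWeakPartial_iff]
    intro φ h
    have h1 := (isWeakPartial_iff k _ _).1 (hp k) φ h
    simp only [WithLp.smul_fst, WithLp.smul_snd, PiLp.smul_apply, inner_smul_right]
    rw [← mul_add, h1, mul_zero]

/-- The Sobolev space `S = H¹(T^d)`. -/
abbrev H1 (d : ℕ) : Type := sobolevH1 d

/-- The embedding `H¹(T^d) → L²(T^d)`. -/
def H1.toL2 {d : ℕ} : H1 d →L[ℝ] L2 d :=
  (WithLp.fstL 2 ℝ (L2 d) (PiLp 2 (fun _ : Fin d => L2 d))).comp (sobolevH1 d).subtypeL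

/-- The weak partial derivative `∂_k : H¹(T^d) → L²(T^d)`. -/
def H1.grad {d : ℕ} (k : Fin d) : H1 d →L[ℝ] L2 d :=
  ((PiLp.proj 2 (fun _ : Fin d => L2 d) k).comp
    (WithLp.sndL 2 ℝ (L2 d) (PiLp 2 (fun _ : Fin d => L2 d)))).comp (sobolevH1 d).subtypeL

theorem isClosed_sobolevH1 (d : ℕ) : IsClosed (sobolevH1 d : Set (WithLp 2 (L2 d × PiLp 2 (fun _ : Fin d => L2 d)))) := by
  have : (sobolevH1 d : Set (WithLp 2 (L2 d × PiLp 2 (fun _ : Fin d => L2 d)))) =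
      ⋂ (k : Fin d) (φ : Torus d → ℝ) (h : IsCk ∞ φ),
        {p | ⟪ContinuousMap.toLp 2 volume ℝ
          (⟨partialD k φ, h.continuous_partialD (by simp) k⟩ : C(Torus d, ℝ)),
            WithLp.fstL 2 ℝ (L2 d) (PiLp 2 (fun _ : Fin d => L2 d)) p⟫ +
        ⟪ContinuousMap.toLp 2 volume ℝ (⟨φ, h.continuous⟩ : C(Torus d, ℝ)),
          PiLp.proj (𝕜 := ℝ) 2 (fun _ : Fin d => L2 d) k
            (WithLp.sndL 2 ℝ (L2 d) (PiLp 2 (fun _ : Fin d => L2 d)) p)⟫ = 0} := by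
    ext p
    simp only [Set.mem_iInter, Set.mem_ofPred_eq]
    exact forall_congr' fun k => isWeakPartial_iff k _ _
  rw [this]
  refine isClosed_iInter fun k => isClosed_iInter fun φ => isClosed_iInter fun h => ?_
  exact isClosed_eq (by fun_prop) continuous_const

instance (d : ℕ) : CompleteSpace (H1 d) := (isClosed_sobolevH1 d).completeSpace_coe

theorem H1.norm_sq {d : ℕ} (u : H1 d) : ‖u‖ ^ 2 = ‖H1.toL2 u‖ ^ 2 + ∑ k, ‖H1.grad k u‖ ^ 2 := by
  rw [show ‖u‖ = ‖(u : WithLp 2 (L2 d × PiLp 2 (fun _ : Fin d => L2 d)))‖ from rfl,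
    WithLp.prod_norm_sq_eq_of_L2, PiLp.norm_sq_eq_of_L2]
  rfl

/-- A coefficient field `ℓ ∈ C²(T^d; ℝ^{m × d})`. -/
structure C2MatrixField (m d : ℕ) where
  toFun : Torus d → Matrix (Fin m) (Fin d) ℝ
  isC2 : ∀ i j, IsCk 2 (fun ξ => toFun ξ i j)

instance (m d : ℕ) : CoeFun (C2MatrixField m d)
    (fun _ => Torus d → Matrix (Fin m) (Fin d) ℝ) := ⟨C2MatrixField.toFun⟩

/-- The entry `ℓ_{ij}` as a continuous function. -/
def C2MatrixField.entry {m d : ℕ} (ℓ : C2MatrixField m d) (i : Fin m) (j : Fin d) :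
    C(Torus d, ℝ) := ⟨fun ξ => ℓ ξ i j, (ℓ.isC2 i j).continuous⟩

/-- Multiplication by a continuous function, as an operator on `L²(T^d)`. -/
def mulL {d : ℕ} (φ : C(Torus d, ℝ)) : L2 d →L[ℝ] L2 d :=
  (ContinuousLinearMap.mul ℝ ℝ).holderL volume ∞ 2 2 (ContinuousMap.toLp ∞ volume ℝ φ)

theorem coeFn_mulL {d : ℕ} (φ : C(Torus d, ℝ)) (u : L2 d) :
    mulL φ u =ᵐ[volume] fun ξ => φ ξ * u ξ := by
  have h1 := (ContinuousLinearMap.mul ℝ ℝ).coeFn_holder (r := 2)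
    (ContinuousMap.toLp ∞ (volume : Measure (Torus d)) ℝ φ) u
  filter_upwards [h1, ContinuousMap.coeFn_toLp (p := ∞) (𝕜 := ℝ)
    (volume : Measure (Torus d)) φ] with ξ h2 h3
  rw [h3] at h2
  exact h2

/-- The `i`-th component `(ℓ∇u)_i = ∑_j ℓ_{ij} ∂_j u ∈ L²(T^d)` of `ℓ∇u`, for `u ∈ H¹(T^d)`. -/
def C2MatrixField.dgrad {m d : ℕ} (ℓ : C2MatrixField m d) (i : Fin m) : H1 d →L[ℝ] L2 d :=
  ∑ j, (mulL (ℓ.entry i j)).comp (H1.grad j)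

theorem C2MatrixField.coeFn_dgrad {m d : ℕ} (ℓ : C2MatrixField m d) (i : Fin m) (u : H1 d) :
    ℓ.dgrad i u =ᵐ[volume] fun ξ => ∑ j, ℓ ξ i j * H1.grad j u ξ := by
  have h1 : ∀ᵐ ξ, ∀ j, mulL (ℓ.entry i j) (H1.grad j u) ξ = ℓ ξ i j * H1.grad j u ξ :=
    ae_all_iff.2 fun j => coeFn_mulL (ℓ.entry i j) (H1.grad j u)
  have h2 : ℓ.dgrad i u = ∑ j, mulL (ℓ.entry i j) (H1.grad j u) := by
    simp [C2MatrixField.dgrad]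
  rw [h2]
  have h5 : ∀ s : Finset (Fin d), ∀ᵐ ξ, (∑ j ∈ s, mulL (ℓ.entry i j) (H1.grad j u) : L2 d) ξ =
      ∑ j ∈ s, mulL (ℓ.entry i j) (H1.grad j u) ξ := by
    intro s
    induction s using Finset.induction_on with
    | empty =>
      filter_upwards [Lp.coeFn_zero ℝ 2 (volume : Measure (Torus d))] with ξ hξ
      simp only [Finset.sum_empty]
      exact hξ
    | insert j s hj ih =>
      rw [Finset.sum_insert hj]
      filter_upwards [ih, Lp.coeFn_add (mulL (ℓ.entry i j) (H1.grad j u))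
        (∑ j ∈ s, mulL (ℓ.entry i j) (H1.grad j u))] with ξ h6 h7
      rw [h7, Finset.sum_insert hj, ← h6]
      rfl
  filter_upwards [h1, h5 Finset.univ] with ξ h3 h4
  rw [h4]
  exact Finset.sum_congr rfl fun j _ => h3 j

theorem inner_eq_integral {d : ℕ} (u v : L2 d) : ⟪u, v⟫ = ∫ ξ, u ξ * v ξ := by
  rw [L2.inner_def]
  refine integral_congr_ae (Filter.Eventually.of_forall fun ξ => ?_)
  exact mul_comm _ _

theorem integrable_mul {d : ℕ} (u v : L2 d) : Integrable (fun ξ => u ξ * v ξ) := by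
  refine (L2.integrable_inner (𝕜 := ℝ) u v).congr (Filter.Eventually.of_forall fun ξ => ?_)
  exact mul_comm _ _

/-- The Dirichlet form `𝓛^ℓ(u, v) = ∫ ⟨ℓ∇u, ℓ∇v⟩ dξ` on `H¹(T^d)`. -/
def C2MatrixField.form {m d : ℕ} (ℓ : C2MatrixField m d) (u v : H1 d) : ℝ :=
  ∫ ξ, ∑ i, ℓ.dgrad i u ξ * ℓ.dgrad i v ξ

theorem C2MatrixField.form_eq_inner {m d : ℕ} (ℓ : C2MatrixField m d) (u v : H1 d) :
    ℓ.form u v = ∑ i, ⟪ℓ.dgrad i u, ℓ.dgrad i v⟫ := by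
  unfold C2MatrixField.form
  rw [integral_finsetSum _ fun i _ => integrable_mul _ _]
  exact Finset.sum_congr rfl fun i _ => (inner_eq_integral _ _).symm

/-- The graph of the Dirichlet operator `L^ℓ` associated with the form `𝓛^ℓ`: `u ∈ D(L^ℓ)` and
`L^ℓ u = w`, that is, `𝓛^ℓ(u, v) = -(w, v)_{L²}` for all `v ∈ H¹(T^d)`. -/
def C2MatrixField.IsDirichletOperator {m d : ℕ} (ℓ : C2MatrixField m d) (u : H1 d) (w : L2 d) :
    Prop :=
  ∀ v : H1 d, ℓ.form u v = -⟪w, H1.toL2 v⟫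

/-- `u = (β - L^ℓ)⁻¹ g`: `u` lies in `D(L^ℓ)` and `β u - L^ℓ u = g`. -/
def C2MatrixField.IsResolvent {m d : ℕ} (ℓ : C2MatrixField m d) (β : ℝ) (g : L2 d) (u : H1 d) :
    Prop :=
  ∃ w : L2 d, ℓ.IsDirichletOperator u w ∧ β • H1.toL2 u - w = g

/-- Condition (E): uniform ellipticity of `a`. -/
def IsElliptic {m d : ℕ} (a : C2MatrixField m d) : Prop :=
  ∃ κ : ℝ, 0 < κ ∧ ∀ (ξ : Torus d) (ζ : Fin d → ℝ),
    κ * ∑ j, ζ j ^ 2 ≤ ∑ i, (a ξ).mulVec ζ i ^ 2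

/-- Condition (D): the rows of `b` are divergence free. -/
def IsDivFree {m d : ℕ} (b : C2MatrixField m d) : Prop :=
  ∀ (i : Fin m) (ξ : Torus d), ∑ j, partialD j (fun η => b η i j) ξ = 0

/-- Condition (R), relating the coefficient fields `a` and `b`. -/
def ConditionR {N d : ℕ} (a : C2MatrixField d d) (b : C2MatrixField N d) : Prop :=
  ∀ (l j : Fin d) (i : Fin N) (ξ : Torus d),
    ∑ k, ∑ p, (b ξ i k * (a ξ p l * partialD k (fun η => a η p j) ξ
          + a ξ p j * partialD k (fun η => a η p l) ξ)
        - a ξ p k * (a ξ p j * partialD k (fun η => b η i l) ξ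
          + a ξ p l * partialD k (fun η => b η i j) ξ)) = 0

theorem IsElliptic.exists_le_form {m d : ℕ} {a : C2MatrixField m d} (ha : IsElliptic a) :
    ∃ κ : ℝ, 0 < κ ∧ ∀ u : H1 d, κ * ∑ k, ‖H1.grad k u‖ ^ 2 ≤ a.form u u := by
  obtain ⟨κ, hκ, h⟩ := ha
  refine ⟨κ, hκ, fun u => ?_⟩
  have hi : ∀ w : L2 d, Integrable (fun ξ => w ξ * w ξ) := fun w => integrable_mul w w
  have hn : ∀ w : L2 d, ‖w‖ ^ 2 = ∫ ξ, w ξ * w ξ := fun w => by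
    rw [← real_inner_self_eq_norm_sq, inner_eq_integral]
  have h1 : κ * ∑ k, ‖H1.grad k u‖ ^ 2 = ∫ ξ, κ * ∑ k, H1.grad k u ξ * H1.grad k u ξ := by
    rw [integral_const_mul, integral_finsetSum _ fun k _ => hi _]
    simp [hn]
  rw [h1]
  unfold C2MatrixField.form
  refine integral_mono_ae ((integrable_finsetSum _ fun k _ => hi _).const_mul κ)
    (integrable_finsetSum _ fun k _ => hi _) ?_
  have h2 : ∀ᵐ ξ, ∀ i, a.dgrad i u ξ = ∑ j, a ξ i j * H1.grad j u ξ :=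
    ae_all_iff.2 fun i => a.coeFn_dgrad i u
  filter_upwards [h2] with ξ h3
  have h4 := h ξ (fun j => H1.grad j u ξ)
  simp only [h3]
  simpa [Matrix.mulVec, dotProduct, pow_two] using h4

theorem existsUnique_of_coercive {E F ι : Type*} [NormedAddCommGroup E] [InnerProductSpace ℝ E]
    [CompleteSpace E] [NormedAddCommGroup F] [InnerProductSpace ℝ F] [Fintype ι]
    (J : E →L[ℝ] F) (T : ι → E →L[ℝ] F) (β c : ℝ) (hc : 0 < c)
    (h : ∀ u, c * ‖u‖ ^ 2 ≤ ∑ i, ⟪T i u, T i u⟫ + β * ⟪J u, J u⟫) (g : F) :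
    ∃! u : E, ∀ v : E, ∑ i, ⟪T i u, T i v⟫ + β * ⟪J u, J v⟫ = ⟪g, J v⟫ := by
  let B : E →L[ℝ] E →L[ℝ] ℝ :=
    β • (innerSL ℝ).bilinearComp J J + ∑ i, (innerSL ℝ).bilinearComp (T i) (T i)
  have hB : ∀ u v, B u v = ∑ i, ⟪T i u, T i v⟫ + β * ⟪J u, J v⟫ := by
    intro u v
    simp [B, add_comm]
  have hco : IsCoercive B := by
    refine ⟨c, hc, fun u => ?_⟩
    rw [hB, mul_assoc, ← pow_two]
    exact h u
  let f : E := (InnerProductSpace.toDual ℝ E).symm ((innerSL ℝ g).comp J)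
  have hf : ∀ v, ⟪f, v⟫ = ⟪g, J v⟫ := fun v => by
    simp [f, InnerProductSpace.toDual_symm_apply]
  refine ⟨hco.continuousLinearEquivOfBilin.symm f, fun v => ?_, fun u hu => ?_⟩
  · rw [← hB, ← hco.continuousLinearEquivOfBilin_apply, ← hf]
    simp
  · have h1 : f = hco.continuousLinearEquivOfBilin u :=
      hco.unique_continuousLinearEquivOfBilin fun v => by rw [hf, hB]; exact (hu v).symm
    rw [h1]
    simp

/-- Under (E), `β - L^a : D(L^a) → L²(T^d)` is bijective for every `β > 0`. -/
theorem IsElliptic.existsUnique_isResolvent {m d : ℕ} {a : C2MatrixField m d}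
    (ha : IsElliptic a) {β : ℝ} (hβ : 0 < β) (g : L2 d) : ∃! u : H1 d, a.IsResolvent β g u := by
  have hiff : ∀ u : H1 d, a.IsResolvent β g u ↔
      ∀ v : H1 d, a.form u v + β * ⟪H1.toL2 u, H1.toL2 v⟫ = ⟪g, H1.toL2 v⟫ := by
    intro u
    constructor
    · rintro ⟨w, hw, rfl⟩ v
      rw [hw v, inner_sub_left, inner_smul_left]
      simp
      ring
    · intro h
      refine ⟨β • H1.toL2 u - g, fun v => ?_, by abel⟩
      rw [inner_sub_left, inner_smul_left, ← h v]
      simp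
  obtain ⟨κ, hκ, hle⟩ := ha.exists_le_form
  have h := existsUnique_of_coercive (E := H1 d) (F := L2 d) (ι := Fin m)
    (H1.toL2 (d := d)) a.dgrad β (min κ β) (lt_min hκ hβ)
    (fun u => by
      rw [← a.form_eq_inner, H1.norm_sq, real_inner_self_eq_norm_sq]
      have h1 := hle u
      have h2 : 0 ≤ ∑ k, ‖H1.grad k u‖ ^ 2 := Finset.sum_nonneg fun k _ => sq_nonneg _
      have h3 : 0 ≤ ‖H1.toL2 u‖ ^ 2 := sq_nonneg _
      have h4 := mul_le_mul_of_nonneg_right (min_le_left κ β) h2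
      have h5 := mul_le_mul_of_nonneg_right (min_le_right κ β) h3
      linarith) g
  simp only [← a.form_eq_inner] at h
  exact (existsUnique_congr hiff).2 h

open Classical in
/-- The resolvent `G^ℓ_β = (β - L^ℓ)⁻¹ : L²(T^d) → D(L^ℓ) ⊆ H¹(T^d)` (with the junk value `0`
where `β u - L^ℓ u = g` has no unique solution, which does not occur for elliptic `ℓ` and `β > 0`). -/
def C2MatrixField.resolvent {m d : ℕ} (ℓ : C2MatrixField m d) (β : ℝ) (g : L2 d) : H1 d :=
  if h : ∃! u : H1 d, ℓ.IsResolvent β g u then h.choose else 0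

theorem IsElliptic.isResolvent_resolvent {m d : ℕ} {a : C2MatrixField m d}
    (ha : IsElliptic a) {β : ℝ} (hβ : 0 < β) (g : L2 d) :
    a.IsResolvent β g (a.resolvent β g) := by
  have h := ha.existsUnique_isResolvent hβ g
  unfold C2MatrixField.resolvent
  rw [dif_pos h]
  exact h.choose_spec.1

end

end TorusForms

open TorusForms

namespace TorusForms

noncomputable section

open Filter Topology

/-! Write α = aᵀa, so that formally L^a = div(α∇), and B = b_i·∇. Condition (R) says that the Lie
derivative of the contravariant tensor α along b_i vanishes, and (D) that the flow of b_i preserves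
Lebesgue measure. Hence this flow preserves L^a, so B commutes with L^a and with its resolvent. The
integrand is then identically zero, and c = 0 works.

To make this rigorous without H² regularity, the commutator is stated weakly: for u, v in D(L^a),
⟨L^a u, Bv⟩ + ⟨L^a v, Bu⟩ = 0 (`inner_dgrad_add_inner_dgrad`). As Bu and Bv need not lie in H¹, they
are not admissible test functions. Weak derivatives are therefore identified with L²-derivatives of
translations (`isWeakPartial_iff_hasDerivAt`), and the equations are tested against C¹ multiples of
translates of u and v. Differentiating in the translation parameter at 0 gives
`inner_mul_grad_add_inner_mul_grad`: translation invariance moves the shift from the gradients onto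
the coefficients, which are differentiable. Skew-symmetry of B and symmetry of the resolvent then
transfer the identity to the resolvent (`toL2_resolvent_dgrad`). -/

/-- A curve is differentiable at `0` as soon as it is so, with a continuous candidate derivative,
when tested against a norming family of functionals. -/
theorem hasDerivAt_of_norming {E : Type*} [NormedAddCommGroup E] [NormedSpace ℝ E]
    (S : Set (E →L[ℝ] ℝ))
    (hS : ∀ (x : E) (C : ℝ), 0 ≤ C → (∀ l ∈ S, ‖l x‖ ≤ C * ‖l‖) → ‖x‖ ≤ C)
    {F G : ℝ → E} (hG : ContinuousAt G 0)
    (hF : ∀ l ∈ S, ∀ t, HasDerivAt (fun s => l (F s)) (l (G t)) t) : HasDerivAt F (G 0) 0 := by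
  rw [hasDerivAt_iff_isLittleO, Asymptotics.isLittleO_iff]
  intro ε hε
  obtain ⟨δ, hδ, hGδ⟩ := Metric.continuousAt_iff.1 hG ε hε
  filter_upwards [Metric.ball_mem_nhds (0 : ℝ) hδ] with s hs
  refine hS _ _ (by positivity) fun l hl => ?_
  -- Mean value inequality for l ∘ F minus its linear part: its derivative l (G t - G 0) is at most
  -- ε‖l‖ on the ball, uniformly in l.
  have hd : ∀ t ∈ Metric.ball (0 : ℝ) δ,
      HasDerivWithinAt (fun s => l (F s) - s * l (G 0)) (l (G t) - 1 * l (G 0))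
        (Metric.ball 0 δ) t := fun t _ =>
    ((hF l hl t).sub ((hasDerivAt_id t).mul_const _)).hasDerivWithinAt
  have hb : ∀ t ∈ Metric.ball (0 : ℝ) δ, ‖l (G t) - 1 * l (G 0)‖ ≤ ‖l‖ * ε := by
    intro t ht
    rw [one_mul, ← map_sub]
    refine (l.le_opNorm _).trans (mul_le_mul_of_nonneg_left ?_ (norm_nonneg _))
    rw [← dist_eq_norm]
    exact (hGδ ht).le
  have h := (convex_ball (0 : ℝ) δ).norm_image_sub_le_of_norm_hasDerivWithin_le hd hb
    (Metric.mem_ball_self hδ) hs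
  simp only [map_sub, map_smul, sub_zero, smul_eq_mul, zero_mul] at h ⊢
  calc _ = ‖l (F s) - s * l (G 0) - l (F 0)‖ := by congr 1; ring
    _ ≤ _ := h
    _ = _ := by ring

/-! ### Translations and multiplication operators on C(T^d) and L²(T^d) -/

variable {d : ℕ}

/-- The point `s e_k` of the torus. -/
def axis (k : Fin d) (s : ℝ) : Torus d := Pi.single k (s : UnitAddCircle)

@[simp] theorem axis_zero (k : Fin d) : axis k 0 = 0 := by simp [axis]

theorem axis_add (k : Fin d) (s t : ℝ) : axis k (s + t) = axis k s + axis k t := by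
  simp [axis, ← Pi.single_add]

theorem axis_neg (k : Fin d) (s : ℝ) : axis k (-s) = -axis k s := by
  simp [axis, ← Pi.single_neg]

theorem continuous_axis (k : Fin d) : Continuous (axis k) :=
  (continuous_single k).comp (AddCircle.continuous_mk' 1)

theorem proj_add_axis (x : Fin d → ℝ) (k : Fin d) (s : ℝ) :
    proj x + axis k s = proj (x + s • (Pi.single k 1 : Fin d → ℝ)) := by
  funext i
  by_cases hi : i = k
  · subst hi; simp [proj, axis]
  · simp [proj, axis, hi]

/-- Translation of a continuous function on the torus. -/
def ctransl (v : Torus d) (φ : C(Torus d, ℝ)) : C(Torus d, ℝ) :=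
  φ.comp ⟨fun ξ => ξ + v, by fun_prop⟩

@[simp] theorem ctransl_apply (v : Torus d) (φ : C(Torus d, ℝ)) (ξ : Torus d) :
    ctransl v φ ξ = φ (ξ + v) := rfl

@[simp] theorem ctransl_zero (φ : C(Torus d, ℝ)) : ctransl 0 φ = φ := by ext; simp

theorem continuous_ctransl (φ : C(Torus d, ℝ)) : Continuous fun v => ctransl v φ := by
  have h : Continuous (Function.uncurry fun (v ξ : Torus d) => φ (ξ + v)) := by fun_prop
  exact (ContinuousMap.curry ⟨_, h⟩).continuous

/-- The translation `u ↦ u(· + v)` of `L²(T^d)`. -/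
def transl (v : Torus d) : L2 d →ₗᵢ[ℝ] L2 d :=
  Lp.compMeasurePreservingₗᵢ ℝ (fun ξ => ξ + v) (measurePreserving_add_right volume v)

theorem coeFn_transl (v : Torus d) (u : L2 d) : transl v u =ᵐ[volume] fun ξ => u (ξ + v) :=
  Lp.coeFn_compMeasurePreserving u (measurePreserving_add_right volume v)

@[simp] theorem transl_zero (u : L2 d) : transl 0 u = u := by
  refine Lp.ext ?_
  filter_upwards [coeFn_transl 0 u] with ξ h
  simpa using h

theorem transl_add (v w : Torus d) (u : L2 d) : transl (v + w) u = transl v (transl w u) := by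
  refine Lp.ext ?_
  filter_upwards [coeFn_transl (v + w) u, coeFn_transl v (transl w u),
    (measurePreserving_add_right volume v).quasiMeasurePreserving.ae (coeFn_transl w u)]
    with ξ h1 h2 h3
  rw [h1, h2, h3, add_assoc]

theorem continuous_transl (u : L2 d) : Continuous fun v => transl v u := by
  have h : Continuous (Function.uncurry fun (v ξ : Torus d) => ξ + v) := by
    simp only [Function.uncurry_def]; fun_prop
  exact (continuous_const (y := u)).compMeasurePreservingLp
    (ContinuousMap.curry ⟨_, h⟩).continuous (fun v => measurePreserving_add_right volume v)
    (by simp)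

/-- The class of a continuous function in `L²(T^d)`. -/
abbrev ofC : C(Torus d, ℝ) →L[ℝ] L2 d := ContinuousMap.toLp 2 volume ℝ

theorem transl_ofC (v : Torus d) (φ : C(Torus d, ℝ)) : transl v (ofC φ) = ofC (ctransl v φ) := by
  refine Lp.ext ?_
  filter_upwards [coeFn_transl v (ofC φ), ContinuousMap.coeFn_toLp (p := 2) (𝕜 := ℝ)
    (volume : Measure (Torus d)) (ctransl v φ),
    (measurePreserving_add_right volume v).quasiMeasurePreserving.ae
      (ContinuousMap.coeFn_toLp (p := 2) (𝕜 := ℝ) (volume : Measure (Torus d)) φ)] with ξ h1 h2 h3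
  rw [h1, h2, h3]
  rfl

theorem inner_transl_left (v : Torus d) (u w : L2 d) : ⟪transl v u, w⟫ = ⟪u, transl (-v) w⟫ := by
  rw [← (transl (-v)).inner_map_map, ← transl_add, neg_add_cancel, transl_zero]

/-- Multiplication of `L²` functions by continuous functions, as a bilinear map. -/
def mulBilin : C(Torus d, ℝ) →L[ℝ] L2 d →L[ℝ] L2 d :=
  ((ContinuousLinearMap.mul ℝ ℝ).holderL volume ∞ 2 2).comp (ContinuousMap.toLp ∞ volume ℝ)

theorem mulBilin_apply (φ : C(Torus d, ℝ)) : mulBilin φ = mulL φ := rfl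

theorem mulL_mul (φ ψ : C(Torus d, ℝ)) (u : L2 d) : mulL (φ * ψ) u = mulL φ (mulL ψ u) := by
  refine Lp.ext ?_
  filter_upwards [coeFn_mulL (φ * ψ) u, coeFn_mulL φ (mulL ψ u), coeFn_mulL ψ u] with ξ h1 h2 h3
  rw [h1, h2, h3, ContinuousMap.mul_apply, mul_assoc]

theorem inner_mulL_left (φ : C(Torus d, ℝ)) (u w : L2 d) : ⟪mulL φ u, w⟫ = ⟪u, mulL φ w⟫ := by
  rw [inner_eq_integral, inner_eq_integral]
  refine integral_congr_ae ?_
  filter_upwards [coeFn_mulL φ u, coeFn_mulL φ w] with ξ h1 h2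
  rw [h1, h2]
  ring

theorem transl_mulL (v : Torus d) (φ : C(Torus d, ℝ)) (u : L2 d) :
    transl v (mulL φ u) = mulL (ctransl v φ) (transl v u) := by
  refine Lp.ext ?_
  filter_upwards [coeFn_transl v (mulL φ u), coeFn_mulL (ctransl v φ) (transl v u),
    coeFn_transl v u, (measurePreserving_add_right volume v).quasiMeasurePreserving.ae
      (coeFn_mulL φ u)] with ξ h1 h2 h3 h4
  rw [h1, h2, h3, h4]
  rfl

/-! ### Continuously differentiable functions -/

theorem IsCk.hasDerivAt_axis {n : WithTop ℕ∞} {φ : Torus d → ℝ} (h : IsCk n φ) (hn : 1 ≤ n)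
    (k : Fin d) (ξ : Torus d) (t : ℝ) :
    HasDerivAt (fun s => φ (ξ + axis k s)) (partialD k φ (ξ + axis k t)) t := by
  obtain ⟨x, rfl⟩ := isOpenQuotientMap_proj.surjective ξ
  have hd := ((ContDiff.differentiable h (by intro h0; simp [h0] at hn))
    (x + t • (Pi.single k 1 : Fin d → ℝ))).hasFDerivAt
  have hl : HasDerivAt (fun t : ℝ => x + t • (Pi.single k 1 : Fin d → ℝ)) (Pi.single k 1) t := by
    simpa using ((hasDerivAt_id t).smul_const (Pi.single k 1 : Fin d → ℝ)).const_add x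
  simp only [proj_add_axis]
  rw [partialD_proj h hn]
  exact hd.comp_hasDerivAt t hl

/-- Point evaluations norm C(T^d), so the pointwise derivative along the axis upgrades to a
derivative in the uniform norm. -/
theorem IsCk.hasDerivAt_ctransl {n : WithTop ℕ∞} {φ : Torus d → ℝ} (h : IsCk n φ) (hn : 1 ≤ n)
    (k : Fin d) : HasDerivAt (fun s => ctransl (axis k s) ⟨φ, h.continuous⟩)
      ⟨partialD k φ, h.continuous_partialD hn k⟩ 0 := by
  have := hasDerivAt_of_norming (E := C(Torus d, ℝ))
    (Set.range fun ξ => ContinuousMap.evalCLM ℝ ξ)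
    (fun x C hC hx => (ContinuousMap.norm_le _ hC).2 fun ξ => by
      refine (hx _ ⟨ξ, rfl⟩).trans (mul_le_of_le_one_right hC ?_)
      refine ContinuousLinearMap.opNorm_le_bound _ zero_le_one fun y => ?_
      rw [one_mul]
      exact y.norm_coe_le_norm ξ)
    (F := fun s => ctransl (axis k s) ⟨φ, h.continuous⟩)
    (G := fun s => ctransl (axis k s) ⟨partialD k φ, h.continuous_partialD hn k⟩)
    ((continuous_ctransl _).comp (continuous_axis k)).continuousAt
    (by
      rintro _ ⟨ξ, rfl⟩ t
      exact h.hasDerivAt_axis hn k ξ t)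
  simpa using this

theorem IsCk.comp_add {n : WithTop ℕ∞} {φ : Torus d → ℝ} (h : IsCk n φ) (v : Torus d) :
    IsCk n fun ξ => φ (ξ + v) := by
  obtain ⟨y, rfl⟩ := isOpenQuotientMap_proj.surjective v
  have h1 : ∀ x : Fin d → ℝ, proj x + proj y = proj (x + y) := fun x => by
    funext i; simp [proj]
  simp only [IsCk, h1]
  exact ContDiff.comp (g := fun x : Fin d → ℝ => φ (proj x)) h (contDiff_id.add contDiff_const)

/-! ### Density of smooth functions -/

/-- The smooth functions, as a subalgebra of the continuous functions. -/
def smoothSubalgebra (d : ℕ) : Subalgebra ℝ C(Torus d, ℝ) where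
  carrier := {φ | IsCk ∞ φ}
  mul_mem' := by
    intro φ ψ hφ hψ
    rw [Set.mem_ofPred_eq] at *
    exact ContDiff.mul hφ hψ
  add_mem' := by
    intro φ ψ hφ hψ
    rw [Set.mem_ofPred_eq] at *
    exact ContDiff.add hφ hψ
  algebraMap_mem' := by
    intro c
    rw [Set.mem_ofPred_eq]
    exact contDiff_const

theorem isCk_comp_coord (i : Fin d) (f : UnitAddCircle → ℝ)
    (hf : ContDiff ℝ ∞ fun t : ℝ => f t) : IsCk ∞ fun ξ : Torus d => f (ξ i) :=
  hf.comp (contDiff_apply ℝ ℝ i)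

/-- The functions cos(2πξ_i) and sin(2πξ_i) already separate points. -/
theorem smoothSubalgebra_separatesPoints : (smoothSubalgebra d).SeparatesPoints := by
  intro ξ η hne
  obtain ⟨i, hi⟩ := Function.ne_iff.1 hne
  have hc : ∀ t : ℝ, (AddCircle.toCircle (t : UnitAddCircle) : ℂ) =
      Complex.exp ((2 * Real.pi * t : ℝ) * Complex.I) := fun t => by
    rw [AddCircle.toCircle_apply_mk, Circle.coe_exp]
    simp
  have hre : IsCk ∞ fun ξ : Torus d => (AddCircle.toCircle (ξ i) : ℂ).re := by
    refine isCk_comp_coord i (fun θ => (AddCircle.toCircle θ : ℂ).re) ?_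
    simp only [hc, Complex.exp_ofReal_mul_I_re]
    fun_prop
  have him : IsCk ∞ fun ξ : Torus d => (AddCircle.toCircle (ξ i) : ℂ).im := by
    refine isCk_comp_coord i (fun θ => (AddCircle.toCircle θ : ℂ).im) ?_
    simp only [hc, Complex.exp_ofReal_mul_I_im]
    fun_prop
  by_contra hcon
  have key : ∀ φ : Torus d → ℝ, IsCk ∞ φ → φ ξ = φ η := fun φ hφ => by
    by_contra h
    exact hcon ⟨φ, ⟨⟨φ, hφ.continuous⟩, hφ, rfl⟩, h⟩
  exact hi (AddCircle.injective_toCircle one_ne_zero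
    (Subtype.ext (Complex.ext (key _ hre) (key _ him))))

/-- Stone–Weierstrass, followed by density of C(T^d) in L². -/
theorem dense_smooth : Dense (ofC '' {φ : C(Torus d, ℝ) | IsCk ∞ φ}) := by
  have h1 : Dense {φ : C(Torus d, ℝ) | IsCk ∞ φ} := by
    have h := ContinuousMap.subalgebra_topologicalClosure_eq_top_of_separatesPoints
      (smoothSubalgebra d) smoothSubalgebra_separatesPoints
    rw [dense_iff_closure_eq]
    exact congrArg (fun A : Subalgebra ℝ C(Torus d, ℝ) => (A : Set C(Torus d, ℝ))) h
  exact (ContinuousMap.toLp_denseRange ℝ (volume : Measure (Torus d)) ℝ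
    (p := 2) ENNReal.ofNat_ne_top).dense_image ofC.continuous h1

/-! ### Weak derivatives as derivatives of translations -/

/-- Against a smooth function the translation can be moved onto that function, so the pairing is
differentiable for any u; the weak derivative identity says what its derivative is. Smooth functions
norm L², which turns this into strong differentiability. -/
theorem isWeakPartial_iff_hasDerivAt {k : Fin d} {u v : L2 d} :
    IsWeakPartial k u v ↔ HasDerivAt (fun s => transl (axis k s) u) v 0 := by
  have hsm : ∀ (φ : Torus d → ℝ) (h : IsCk ∞ φ), HasDerivAt
      (fun s => ⟪transl (axis k s) u, ofC ⟨φ, h.continuous⟩⟫)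
      (-⟪ofC ⟨partialD k φ, h.continuous_partialD (by simp) k⟩, u⟫) 0 := by
    intro φ h
    have h1 := (ofC.hasFDerivAt.comp_hasDerivAt (0 : ℝ) (h.hasDerivAt_ctransl (by simp) k))
    have h2 : HasDerivAt (fun s : ℝ => ofC (ctransl (axis k (-s)) ⟨φ, h.continuous⟩))
        (-ofC ⟨partialD k φ, h.continuous_partialD (by simp) k⟩) 0 := by
      have := HasDerivAt.scomp (0 : ℝ) (h := fun s : ℝ => -s) (by simpa using h1)
        (hasDerivAt_neg (0 : ℝ))
      simpa [Function.comp_def] using this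
    have h3 := ((innerSL ℝ u).hasFDerivAt.comp_hasDerivAt (0 : ℝ) h2)
    simp only [inner_transl_left, transl_ofC, ← axis_neg]
    simpa [Function.comp_def, real_inner_comm] using h3
  rw [isWeakPartial_iff]
  constructor
  · intro h
    have := hasDerivAt_of_norming (E := L2 d)
      ((fun φ => innerSL ℝ (ofC φ)) '' {φ : C(Torus d, ℝ) | IsCk ∞ φ})
      (fun x C hC hx => by
        -- The bound is closed in y, so it extends from smooth functions to all of L²; then y = x is
        -- taken.
        have hall : ∀ y : L2 d, ‖⟪y, x⟫‖ ≤ C * ‖y‖ := by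
          have hcl : IsClosed {y : L2 d | ‖⟪y, x⟫‖ ≤ C * ‖y‖} :=
            isClosed_le (by fun_prop) (by fun_prop)
          intro y
          refine hcl.closure_subset_iff.2 ?_ (dense_smooth y)
          rintro _ ⟨φ, hφ, rfl⟩
          simpa using hx _ ⟨φ, hφ, rfl⟩
        have h1 := hall x
        rw [real_inner_self_eq_norm_sq, Real.norm_of_nonneg (by positivity)] at h1
        by_contra! hlt
        nlinarith)
      (F := fun s => transl (axis k s) u) (G := fun s => transl (axis k s) v)
      ((continuous_transl _).comp (continuous_axis k)).continuousAt
      (by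
        rintro _ ⟨φ, hφ, rfl⟩ t
        rw [Set.mem_ofPred_eq] at hφ
        -- Differentiability at t reduces to differentiability at 0 with the test function
        -- translated by -t e_k.
        have hφt := IsCk.comp_add hφ (-axis k t)
        have h1 := hsm _ hφt
        have h2 := h _ hφt
        have h3 : HasDerivAt (fun s => ⟪transl (axis k s) u, transl (-axis k t) (ofC φ)⟫)
            ⟪v, transl (-axis k t) (ofC φ)⟫ (t - t) := by
          rw [transl_ofC, sub_self, real_inner_comm]
          rw [← eq_neg_of_add_eq_zero_right h2] at h1
          exact h1
        have h4 := h3.comp_sub_const t t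
        simp only [innerSL_apply_apply, real_inner_comm _ (ofC φ)]
        rw [inner_transl_left]
        have heq : (fun s => ⟪transl (axis k s) u, ofC φ⟫) =
            fun s => ⟪transl (axis k (s - t)) u, transl (-axis k t) (ofC φ)⟫ := by
          funext s
          rw [← inner_transl_left, ← transl_add, ← axis_add, add_sub_cancel]
        rw [heq]
        exact h4)
    simpa using this
  · intro h φ hφ
    have h1 := hsm φ hφ
    have h2 := (innerSL ℝ (ofC ⟨φ, hφ.continuous⟩)).hasFDerivAt.comp_hasDerivAt (0 : ℝ) h
    have h3 := h1.unique (by simpa [Function.comp_def, real_inner_comm] using h2)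
    rw [real_inner_comm v, ← h3, add_neg_cancel]

/-! ### Product rule and integration by parts -/

/-- `φ'` is the partial derivative `∂_k φ`, in the sense of uniform limits of difference quotients. -/
def HasCPartial (k : Fin d) (φ φ' : C(Torus d, ℝ)) : Prop :=
  HasDerivAt (fun s => ctransl (axis k s) φ) φ' 0

theorem HasCPartial.mul {k : Fin d} {φ φ' ψ ψ' : C(Torus d, ℝ)} (hφ : HasCPartial k φ φ')
    (hψ : HasCPartial k ψ ψ') : HasCPartial k (φ * ψ) (φ' * ψ + φ * ψ') := by
  have h := HasDerivAt.mul (𝔸 := C(Torus d, ℝ)) hφ hψ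
  simp only [axis_zero, ctransl_zero] at h
  exact h

theorem HasCPartial.sum {ι : Type*} {s : Finset ι} {k : Fin d} {φ φ' : ι → C(Torus d, ℝ)}
    (h : ∀ i ∈ s, HasCPartial k (φ i) (φ' i)) : HasCPartial k (∑ i ∈ s, φ i) (∑ i ∈ s, φ' i) := by
  have h1 := HasDerivAt.fun_sum h
  refine h1.congr_of_eventuallyEq (Eventually.of_forall fun t => ?_)
  ext ξ
  simp [ContinuousMap.sum_apply]

theorem HasCPartial.mulL {k : Fin d} {φ φ' : C(Torus d, ℝ)} {u v : L2 d}
    (hφ : HasCPartial k φ φ') (h : HasDerivAt (fun s => transl (axis k s) u) v 0) :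
    HasDerivAt (fun s => transl (axis k s) (mulL φ u)) (mulL φ v + mulL φ' u) 0 := by
  have h1 := (mulBilin (d := d)).hasDerivAt_of_bilinear (fun _ => hφ) (fun _ => h)
  simp only [axis_zero, ctransl_zero, transl_zero] at h1
  simpa only [transl_mulL, mulBilin_apply] using h1

theorem H1.hasDerivAt_transl (k : Fin d) (u : H1 d) :
    HasDerivAt (fun s => transl (axis k s) (H1.toL2 u)) (H1.grad k u) 0 :=
  isWeakPartial_iff_hasDerivAt.1 (u.2 k)

/-- The element of `H¹(T^d)` given by a function and its weak partial derivatives. -/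
def H1.mk (u : L2 d) (g : Fin d → L2 d)
    (h : ∀ k, HasDerivAt (fun s => transl (axis k s) u) (g k) 0) : H1 d :=
  ⟨WithLp.toLp 2 (u, WithLp.toLp 2 g), fun k => isWeakPartial_iff_hasDerivAt.2 (h k)⟩

/-- Translation on `H¹(T^d)`. -/
def H1.shift (v : Torus d) (u : H1 d) : H1 d :=
  H1.mk (transl v (H1.toL2 u)) (fun k => transl v (H1.grad k u)) fun k => by
    have h := (transl v).toContinuousLinearMap.hasFDerivAt.comp_hasDerivAt (0 : ℝ)
      (u.hasDerivAt_transl k)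
    refine h.congr_of_eventuallyEq (Eventually.of_forall fun s => ?_)
    simp only [Function.comp, LinearIsometry.coe_toContinuousLinearMap, ← transl_add]
    rw [add_comm]

/-- Multiplication of an `H¹` function by a `C¹` function. -/
def H1.smulC (φ : C(Torus d, ℝ)) (φ' : Fin d → C(Torus d, ℝ))
    (hφ : ∀ k, HasCPartial k φ (φ' k)) (u : H1 d) : H1 d :=
  H1.mk (mulL φ (H1.toL2 u)) (fun k => mulL φ (H1.grad k u) + mulL (φ' k) (H1.toL2 u)) fun k =>
    (hφ k).mulL (u.hasDerivAt_transl k)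

/-- Integration by parts: translating both factors leaves their inner product constant, so its
derivative vanishes. -/
theorem inner_add_inner_of_hasDerivAt {k : Fin d} {u u' w w' : L2 d}
    (hu : HasDerivAt (fun s => transl (axis k s) u) u' 0)
    (hw : HasDerivAt (fun s => transl (axis k s) w) w' 0) : ⟪u, w'⟫ + ⟪u', w⟫ = 0 := by
  have h := hu.inner ℝ hw
  simp only [LinearIsometry.inner_map_map, axis_zero, transl_zero] at h
  exact h.unique (hasDerivAt_const _ _)

/-- The partial derivative `∂_k ℓ_{ij}` as a continuous function. -/
def C2MatrixField.dentry {m : ℕ} (ℓ : C2MatrixField m d) (k : Fin d) (i : Fin m) (j : Fin d) :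
    C(Torus d, ℝ) :=
  ⟨partialD k (fun η => ℓ η i j), (ℓ.isC2 i j).continuous_partialD (by norm_num) k⟩

theorem C2MatrixField.hasCPartial {m : ℕ} (ℓ : C2MatrixField m d) (k : Fin d) (i : Fin m)
    (j : Fin d) : HasCPartial k (ℓ.entry i j) (ℓ.dentry k i j) :=
  (ℓ.isC2 i j).hasDerivAt_ctransl (by norm_num) k

theorem C2MatrixField.dgrad_apply {m : ℕ} (ℓ : C2MatrixField m d) (i : Fin m) (u : H1 d) :
    ℓ.dgrad i u = ∑ j, mulL (ℓ.entry i j) (H1.grad j u) := by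
  simp [C2MatrixField.dgrad]

/-- The functional `φ ↦ ∫ φ g h`. -/
def pairing (g h : L2 d) : C(Torus d, ℝ) →L[ℝ] ℝ := (innerSL ℝ g).comp (mulBilin.flip h)

theorem pairing_apply (g h : L2 d) (φ : C(Torus d, ℝ)) : pairing g h φ = ⟪g, mulL φ h⟫ := rfl

theorem pairing_comm (g h : L2 d) (φ : C(Torus d, ℝ)) : pairing g h φ = pairing h g φ := by
  rw [pairing_apply, pairing_apply, ← inner_mulL_left, real_inner_comm]

/-- A divergence free field is skew-symmetric as a first order operator. -/
theorem IsDivFree.inner_dgrad {m : ℕ} {b : C2MatrixField m d} (hb : IsDivFree b) (i : Fin m)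
    (u v : H1 d) : ⟪b.dgrad i u, H1.toL2 v⟫ = -⟪H1.toL2 u, b.dgrad i v⟫ := by
  have hk : ∀ k, ⟪mulL (b.entry i k) (H1.grad k u), H1.toL2 v⟫ +
      ⟪H1.toL2 u, mulL (b.entry i k) (H1.grad k v)⟫ +
        pairing (H1.toL2 u) (H1.toL2 v) (b.dentry k i k) = 0 := by
    intro k
    have h := inner_add_inner_of_hasDerivAt (u.hasDerivAt_transl k)
      ((b.hasCPartial k i k).mulL (v.hasDerivAt_transl k))
    rw [inner_add_right] at h
    rw [inner_mulL_left, pairing_apply]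
    linarith
  have h0 : ∑ k, b.dentry k i k = 0 := by
    ext ξ
    rw [ContinuousMap.sum_apply]
    exact hb i ξ
  have hs := Finset.sum_eq_zero fun k (_ : k ∈ Finset.univ) => hk k
  rw [Finset.sum_add_distrib, Finset.sum_add_distrib, ← map_sum, h0, map_zero, add_zero,
    ← sum_inner, ← inner_sum, ← b.dgrad_apply, ← b.dgrad_apply] at hs
  linarith

/-! ### The commutator identity -/

/-- Where one factor vanishes, the other need only be continuous. This lets f be a translated
gradient, which has no derivative in general. -/
theorem HasDerivAt.inner_of_eq_zero {E : Type*} [NormedAddCommGroup E] [InnerProductSpace ℝ E]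
    {f g : ℝ → E} {g' : E} (hf : ContinuousAt f 0) (hg : HasDerivAt g g' 0) (h0 : g 0 = 0) :
    HasDerivAt (fun s => ⟪f s, g s⟫) ⟪f 0, g'⟫ 0 := by
  rw [hasDerivAt_iff_tendsto_slope_zero] at hg ⊢
  refine ((hf.tendsto.mono_left nhdsWithin_le_nhds).inner hg).congr fun t => ?_
  simp [h0, inner_smul_right]

/-- Testing `∑ ∂_j(α_{jl} ∂_l u) = w` against `β ∂_k v` and `∑ ∂_j(α_{jl} ∂_l v) = z` against
`β ∂_k u`, without second derivatives of `u` and `v`. -/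
theorem inner_mul_grad_add_inner_mul_grad (k : Fin d) {α γ : Fin d → Fin d → C(Torus d, ℝ)}
    (hα : ∀ j l, α j l = α l j) {β : C(Torus d, ℝ)} {β' : Fin d → C(Torus d, ℝ)}
    (hβ : ∀ j, HasCPartial j β (β' j)) (hγ : ∀ j l, HasCPartial k (α j l * β) (γ j l))
    {u v : H1 d} {w z : L2 d}
    (hu : ∀ ψ : H1 d, ∑ j, ∑ l, pairing (H1.grad j u) (H1.grad l ψ) (α j l) = -⟪w, H1.toL2 ψ⟫)
    (hv : ∀ ψ : H1 d, ∑ j, ∑ l, pairing (H1.grad j v) (H1.grad l ψ) (α j l) = -⟪z, H1.toL2 ψ⟫) :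
    ⟪w, mulL β (H1.grad k v)⟫ + ⟪z, mulL β (H1.grad k u)⟫ =
      ∑ j, ∑ l, (pairing (H1.grad j u) (H1.grad l v) (γ j l) -
        pairing (H1.grad k u) (H1.grad l v) (α j l * β' j) -
        pairing (H1.grad j u) (H1.grad k v) (α j l * β' l)) := by
  have hneg : ∀ g : H1 d, HasDerivAt (fun s => transl (axis k (-s)) (H1.toL2 g))
      (-H1.grad k g) 0 := fun g => by
    have := HasDerivAt.scomp (0 : ℝ) (h := fun s : ℝ => -s)
      (by simpa using g.hasDerivAt_transl k) (hasDerivAt_neg (0 : ℝ))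
    simpa [Function.comp_def] using this
  -- The shifts have opposite signs, so that the leading terms of the two tested equations combine
  -- in `heq` into a single increment of α β.
  have hL : HasDerivAt (fun s => -⟪z, mulL β (transl (axis k s) (H1.toL2 u))⟫ -
      -⟪w, mulL β (transl (axis k (-s)) (H1.toL2 v))⟫)
      (-⟪z, mulL β (H1.grad k u)⟫ - -⟪w, mulL β (-H1.grad k v)⟫) 0 :=
    (((innerSL ℝ z).comp (mulL β)).hasFDerivAt.comp_hasDerivAt (0 : ℝ)
      (u.hasDerivAt_transl k)).neg.sub
    (((innerSL ℝ w).comp (mulL β)).hasFDerivAt.comp_hasDerivAt (0 : ℝ) (hneg v)).neg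
  have hR : HasDerivAt (fun s => ∑ j, ∑ l,
      (⟪H1.grad l v, mulL (α j l * β' j) (transl (axis k s) (H1.toL2 u))⟫ -
        ⟪H1.grad j u, mulL (α j l * β' l) (transl (axis k (-s)) (H1.toL2 v))⟫ +
        ⟪transl (axis k s) (H1.grad j u),
          mulBilin (α j l * β - ctransl (axis k s) (α j l * β)) (H1.grad l v)⟫))
      (∑ j, ∑ l, (⟪H1.grad l v, mulL (α j l * β' j) (H1.grad k u)⟫ -
        ⟪H1.grad j u, mulL (α j l * β' l) (-H1.grad k v)⟫ +
        ⟪H1.grad j u, mulBilin (-γ j l) (H1.grad l v)⟫)) 0 := by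
    refine HasDerivAt.fun_sum fun j _ => HasDerivAt.fun_sum fun l _ => ?_
    refine HasDerivAt.add (HasDerivAt.sub ?_ ?_) ?_
    · exact ((innerSL ℝ _).comp (mulL _)).hasFDerivAt.comp_hasDerivAt (0 : ℝ)
        (u.hasDerivAt_transl k)
    · exact ((innerSL ℝ _).comp (mulL _)).hasFDerivAt.comp_hasDerivAt (0 : ℝ) (hneg v)
    · have h1 : HasDerivAt
          (fun s => mulBilin (α j l * β - ctransl (axis k s) (α j l * β)) (H1.grad l v))
          (mulBilin (-γ j l) (H1.grad l v)) 0 :=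
        (mulBilin.flip (H1.grad l v)).hasFDerivAt.comp_hasDerivAt (0 : ℝ)
          ((hγ j l).const_sub (α j l * β))
      have h2 := HasDerivAt.inner_of_eq_zero (f := fun s => transl (axis k s) (H1.grad j u))
        ((continuous_transl _).comp (continuous_axis k)).continuousAt h1 (by simp)
      simpa using h2
  have heq : (fun s => -⟪z, mulL β (transl (axis k s) (H1.toL2 u))⟫ -
      -⟪w, mulL β (transl (axis k (-s)) (H1.toL2 v))⟫) = fun s => ∑ j, ∑ l,
      (⟪H1.grad l v, mulL (α j l * β' j) (transl (axis k s) (H1.toL2 u))⟫ -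
        ⟪H1.grad j u, mulL (α j l * β' l) (transl (axis k (-s)) (H1.toL2 v))⟫ +
        ⟪transl (axis k s) (H1.grad j u),
          mulBilin (α j l * β - ctransl (axis k s) (α j l * β)) (H1.grad l v)⟫) := by
    funext s
    have h1 := hv (H1.smulC β β' hβ (u.shift (axis k s)))
    have h2 := hu (H1.smulC β β' hβ (v.shift (axis k (-s))))
    rw [Finset.sum_comm] at h1
    refine (congrArg₂ (· - ·) h1.symm h2.symm).trans ?_
    rw [← Finset.sum_sub_distrib]
    refine Finset.sum_congr rfl fun j _ => ?_
    rw [← Finset.sum_sub_distrib]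
    refine Finset.sum_congr rfl fun l _ => ?_
    have e1 : ∀ (g : H1 d) (i : Fin d) (t : Torus d),
        H1.grad i (H1.smulC β β' hβ (g.shift t)) =
          mulL β (transl t (H1.grad i g)) + mulL (β' i) (transl t (H1.toL2 g)) :=
      fun _ _ _ => rfl
    -- Translating the whole integral by s e_k moves the shift off ∂_l v, onto ∂_j u and the
    -- coefficient.
    have e2 : ⟪H1.grad j u, mulL (α j l * β) (transl (axis k (-s)) (H1.grad l v))⟫ =
        ⟪transl (axis k s) (H1.grad j u),
          mulL (ctransl (axis k s) (α j l * β)) (H1.grad l v)⟫ := by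
      rw [← (transl (axis k s)).inner_map_map, transl_mulL, ← transl_add, ← axis_add]
      simp
    have e3 : ⟪H1.grad l v, mulL (α j l * β) (transl (axis k s) (H1.grad j u))⟫ =
        ⟪transl (axis k s) (H1.grad j u), mulL (α j l * β) (H1.grad l v)⟫ :=
      pairing_comm _ _ _
    rw [pairing_apply, pairing_apply, e1, e1, hα l j, map_add, map_add, ← mulL_mul, ← mulL_mul,
      ← mulL_mul, ← mulL_mul, inner_add_right, inner_add_right, e2, e3, map_sub,
      sub_apply, inner_sub_right, mulBilin_apply, mulBilin_apply]
    ring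
  rw [heq] at hL
  have h := hL.unique hR
  simp only [map_neg, inner_neg_right, neg_apply] at h
  rw [show ⟪w, mulL β (H1.grad k v)⟫ + ⟪z, mulL β (H1.grad k u)⟫ =
    -(-⟪z, mulL β (H1.grad k u)⟫ - - -⟪w, mulL β (H1.grad k v)⟫) by ring, h,
    ← Finset.sum_neg_distrib]
  refine Finset.sum_congr rfl fun j _ => ?_
  rw [← Finset.sum_neg_distrib]
  refine Finset.sum_congr rfl fun l _ => ?_
  rw [pairing_comm (H1.grad k u), pairing_apply, pairing_apply, pairing_apply, mulBilin_apply]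
  ring

/-- The coefficient `(ℓᵀℓ)_{jl}` of the form `𝓛^ℓ`. -/
def C2MatrixField.gram {m : ℕ} (ℓ : C2MatrixField m d) (j l : Fin d) : C(Torus d, ℝ) :=
  ∑ p, ℓ.entry p j * ℓ.entry p l

theorem C2MatrixField.gram_comm {m : ℕ} (ℓ : C2MatrixField m d) (j l : Fin d) :
    ℓ.gram j l = ℓ.gram l j :=
  Finset.sum_congr rfl fun _ _ => mul_comm _ _

theorem C2MatrixField.form_eq_sum_pairing {m : ℕ} (ℓ : C2MatrixField m d) (u v : H1 d) :
    ℓ.form u v = ∑ j, ∑ l, pairing (H1.grad j u) (H1.grad l v) (ℓ.gram j l) := by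
  rw [ℓ.form_eq_inner]
  simp only [ℓ.dgrad_apply, sum_inner, inner_sum, C2MatrixField.gram, map_sum]
  rw [Finset.sum_comm]
  refine (Finset.sum_congr rfl fun l _ => Finset.sum_comm).trans ?_
  rw [Finset.sum_comm]
  refine Finset.sum_congr rfl fun j _ => Finset.sum_congr rfl fun l _ =>
    Finset.sum_congr rfl fun p _ => ?_
  rw [pairing_apply, mulL_mul, inner_mulL_left]

/-- Under (R) and (D), the operator `b_i · ∇` commutes weakly with `L^a`. -/
theorem inner_dgrad_add_inner_dgrad {N : ℕ} {a : C2MatrixField d d} {b : C2MatrixField N d}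
    (hR : ConditionR a b) (hD : IsDivFree b) (i : Fin N) {u v : H1 d} {w z : L2 d}
    (hu : a.IsDirichletOperator u w) (hv : a.IsDirichletOperator v z) :
    ⟪w, b.dgrad i v⟫ + ⟪z, b.dgrad i u⟫ = 0 := by
  let α' : Fin d → Fin d → Fin d → C(Torus d, ℝ) := fun k j l =>
    ∑ p, (a.dentry k p j * a.entry p l + a.entry p j * a.dentry k p l)
  have hα' : ∀ k j l, HasCPartial k (a.gram j l) (α' k j l) := fun k j l =>
    HasCPartial.sum fun p _ => (a.hasCPartial k p j).mul (a.hasCPartial k p l)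
  have hk := fun k => inner_mul_grad_add_inner_mul_grad k a.gram_comm
    (fun j => b.hasCPartial j i k) (fun j l => (hα' k j l).mul (b.hasCPartial k i k))
    (fun ψ => (a.form_eq_sum_pairing u ψ).symm.trans (hu ψ))
    (fun ψ => (a.form_eq_sum_pairing v ψ).symm.trans (hv ψ))
  rw [b.dgrad_apply, b.dgrad_apply, inner_sum, inner_sum, ← Finset.sum_add_distrib,
    Finset.sum_congr rfl fun k _ => hk k]
  simp only [Finset.sum_sub_distrib]
  -- Indices are relabelled so that all three sums pair ∂_j u with ∂_l v. It then suffices that the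
  -- total coefficient vanishes pointwise: it is the Lie derivative of α along b_i, zero by (R),
  -- plus α_{jl} div b_i, zero by (D).
  have hX : ∑ k, ∑ j, ∑ l, pairing (H1.grad j u) (H1.grad l v)
      (α' k j l * b.entry i k + a.gram j l * b.dentry k i k) =
      ∑ j, ∑ l, ∑ k, pairing (H1.grad j u) (H1.grad l v)
        (α' k j l * b.entry i k + a.gram j l * b.dentry k i k) := by
    rw [Finset.sum_comm]
    exact Finset.sum_congr rfl fun j _ => Finset.sum_comm
  have hY : ∑ k, ∑ j, ∑ l, pairing (H1.grad k u) (H1.grad l v) (a.gram j l * b.dentry j i k) =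
      ∑ j, ∑ l, ∑ k, pairing (H1.grad j u) (H1.grad l v) (a.gram k l * b.dentry k i j) :=
    Finset.sum_congr rfl fun j _ => Finset.sum_comm
  have hZ : ∑ k, ∑ j, ∑ l, pairing (H1.grad j u) (H1.grad k v) (a.gram j l * b.dentry l i k) =
      ∑ j, ∑ l, ∑ k, pairing (H1.grad j u) (H1.grad l v) (a.gram j k * b.dentry k i l) :=
    Finset.sum_comm
  rw [hX, hY, hZ]
  simp only [← Finset.sum_sub_distrib, ← map_sub, ← map_sum]
  refine Finset.sum_eq_zero fun j _ => Finset.sum_eq_zero fun l _ => ?_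
  convert map_zero (pairing (H1.grad j u) (H1.grad l v))
  ext ξ
  have h1 := hR l j i ξ
  have h2 := hD i ξ
  have h3 : ∑ k, a.gram j l ξ * partialD k (fun η => b η i k) ξ = 0 := by
    rw [← Finset.mul_sum, h2, mul_zero]
  rw [ContinuousMap.sum_apply]
  refine Eq.trans ?_ ((congrArg₂ (· + ·) h1 h3).trans (add_zero 0))
  rw [← Finset.sum_add_distrib]
  refine Finset.sum_congr rfl fun k _ => ?_
  have h4 : α' k j l ξ * b ξ i k - a.gram k l ξ * partialD k (fun η => b η i j) ξ -
      a.gram j k ξ * partialD k (fun η => b η i l) ξ =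
      ∑ p, (b ξ i k * (a ξ p l * partialD k (fun η => a η p j) ξ
          + a ξ p j * partialD k (fun η => a η p l) ξ)
        - a ξ p k * (a ξ p j * partialD k (fun η => b η i l) ξ
          + a ξ p l * partialD k (fun η => b η i j) ξ)) := by
    simp only [α', C2MatrixField.gram, ContinuousMap.sum_apply, Finset.sum_mul,
      ← Finset.sum_sub_distrib]
    refine Finset.sum_congr rfl fun p _ => ?_
    simp only [ContinuousMap.add_apply, ContinuousMap.mul_apply, C2MatrixField.entry,
      C2MatrixField.dentry, ContinuousMap.coe_mk]
    ring
  rw [← h4]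
  simp only [ContinuousMap.sub_apply, ContinuousMap.add_apply, ContinuousMap.mul_apply,
    C2MatrixField.entry, C2MatrixField.dentry, ContinuousMap.coe_mk]
  ring

/-! ### Commutation with the resolvent -/

/-- The weak form of (β - L^ℓ)u = g, in which L^ℓ u no longer appears. -/
theorem C2MatrixField.IsResolvent.form_add {m : ℕ} {ℓ : C2MatrixField m d} {β : ℝ} {g : L2 d}
    {u : H1 d} (h : ℓ.IsResolvent β g u) (v : H1 d) :
    ℓ.form u v + β * ⟪H1.toL2 u, H1.toL2 v⟫ = ⟪g, H1.toL2 v⟫ := by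
  obtain ⟨w, hw, rfl⟩ := h
  rw [hw v, inner_sub_left, real_inner_smul_left]
  ring

theorem C2MatrixField.form_comm {m : ℕ} (ℓ : C2MatrixField m d) (u v : H1 d) :
    ℓ.form u v = ℓ.form v u := by
  rw [ℓ.form_eq_inner, ℓ.form_eq_inner]
  exact Finset.sum_congr rfl fun i _ => real_inner_comm _ _

/-- Under (R) and (D), the resolvent of `L^a` commutes with `b_i · ∇`. -/
theorem toL2_resolvent_dgrad {N : ℕ} {a : C2MatrixField d d} {b : C2MatrixField N d}
    (hE : IsElliptic a) (hR : ConditionR a b) (hD : IsDivFree b) {β : ℝ} (hβ : 0 < β) (i : Fin N)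
    (f : H1 d) : H1.toL2 (a.resolvent β (b.dgrad i f)) =
      b.dgrad i (a.resolvent β (H1.toL2 f)) := by
  refine ext_inner_right ℝ fun g => ?_
  have hv := hE.isResolvent_resolvent hβ g
  have hu := hE.isResolvent_resolvent hβ (H1.toL2 f)
  have hU := (hE.isResolvent_resolvent hβ (b.dgrad i f)).form_add (a.resolvent β g)
  have hV := hv.form_add (a.resolvent β (b.dgrad i f))
  set u := a.resolvent β (H1.toL2 f)
  set v := a.resolvent β g
  set U := a.resolvent β (b.dgrad i f)
  obtain ⟨w, hw, hwf⟩ := hu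
  obtain ⟨z, hz, hzg⟩ := hv
  have h1 := inner_dgrad_add_inner_dgrad hR hD i hw hz
  have h2 := hD.inner_dgrad i u v
  have h3 := hD.inner_dgrad i f v
  -- Symmetry of the resolvent and skewness of B give ⟨U, g⟩ = ⟨Bf, v⟩ = -⟨f, Bv⟩. With f = βu - w
  -- and g = βz' - z, where z' is v in L², the weak commutation `h1` turns this into ⟨Bu, g⟩.
  rw [real_inner_comm, ← hV, a.form_comm v U, real_inner_comm (H1.toL2 U), hU, h3, ← hzg, ← hwf,
    inner_sub_left, inner_sub_right, real_inner_smul_left, real_inner_smul_right, h2,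
    real_inner_comm z]
  linarith

end

end TorusForms

theorem mainTheorem4 {d N : ℕ} (a : C2MatrixField d d) (b : C2MatrixField N d)
    (hE : IsElliptic a) (hR : ConditionR a b) (hD : IsDivFree b) :
    ∃ c : ℝ, c ≤ 0 ∧ ∀ β : ℝ, 0 < β → ∀ f : H1 d,
      β * (∫ ξ, ∑ i, (β * H1.toL2 (a.resolvent β (b.dgrad i f)) ξ
            - β * b.dgrad i (a.resolvent β (H1.toL2 f)) ξ) * b.dgrad i f ξ)
        ≥ c * a.form f f := by
  -- Commutation is exact, so there is no defect and c = 0 suffices.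
  refine ⟨0, le_rfl, fun β hβ f => ?_⟩
  simp [toL2_resolvent_dgrad hE hR hD hβ]
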